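/- Let $n\ge 1$. For $p\in[1,\infty]$ let $1/p+1/p'=1$ and let $\widehat L^{p}(\mathbb R^n)$ be the space of all $f\in L^{p}(\mathbb R^n)$ that are the (distributional) Fourier transform of some $g\in L^{p'}(\mathbb R^n)$, with the norm $\|f\|_{\widehat L^{p}}=\|\widehat f\,\|_{p'}$. For a finite complex Borel measure $\mu$ on $\mathbb R^n$ put $$\|\mu\|_p^*=\sup\Big\{\Big|\int_{\mathbb R^n}h\,d\mu\Big| \;:\; h\in\widehat L^{p'}(\mathbb R^n),\ \|h\|_{\widehat L^{p'}}\le 1\Big\},$$ where $h$ runs over the elements of $\widehat L^{p'}(\mathbb R^n)$ that have a continuous representative, and that representative, required to be $|\mu|$-integrable, is used in the integral. Write $\mu\in\mathcal M_p$ if $\|\mu\|_p^*<\infty$. The Fourier–Stieltjes transform of $\mu$ is $\widehat\mu(y)=\int_{\mathbb R^n}e^{-2\pi i x\cdot y}\,d\mu(x)$. The measure $\mu$ is supported in a set $F\subset\mathbb R^n$ if $\mu(A)=0$ for every Borel set $A$ disjoint from $F$, and the function $\widehat\mu$ is supported in a set $E\subset\mathbb R^n$ if $\widehat\mu=0$ Lebesgue-almost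 everywhere outside $E$. **Theorem.** Let $\mu$ be a nonzero finite complex Borel measure on $\mathbb R^n$ with $\mu\in\mathcal M_2$. Then $\mu$ and $\widehat\mu$ cannot both be supported in sets of finite Lebesgue measure: there are no sets $E,F\subset\mathbb R^n$ of finite Lebesgue measure such that $\mu$ is supported in $F$ and $\widehat\mu$ is supported in $E$. -/

import Mathlib

open MeasureTheory
open scoped ENNReal FourierTransform SchwartzMap

noncomputable section

namespace MeasureLp

/-- The integral `∫ h dμ` of a complex function against a finite complex Borel measure on `ℝⁿ`
(the pairing is multiplication in `ℂ`). -/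
def cintegral {n : ℕ} (μ : ComplexMeasure (EuclideanSpace ℝ (Fin n)))
    (h : EuclideanSpace ℝ (Fin n) → ℂ) : ℂ :=
  ∫ᵛ x, h x ∂[ContinuousLinearMap.mul ℝ ℂ; μ]

/-- The Fourier–Stieltjes transform `μ̂(y) = ∫ exp(-2πi x·y) dμ(x)`. -/
def fourierStieltjes {n : ℕ} (μ : ComplexMeasure (EuclideanSpace ℝ (Fin n)))
    (y : EuclideanSpace ℝ (Fin n)) : ℂ :=
  cintegral μ fun x => Complex.exp (-2 * Real.pi * Complex.I * (inner ℝ x y : ℝ))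

/-- `k` is the Fourier transform of `f` in the sense of tempered distributions:
`⟨k, ψ⟩ = ⟨f, ψ̂⟩` for every Schwartz function `ψ`. It is used for `f` and `k` in
Lebesgue spaces only, so that all the integrals converge. -/
def IsFourierTransform {n : ℕ} (f k : EuclideanSpace ℝ (Fin n) → ℂ) : Prop :=
  ∀ ψ : 𝓢(EuclideanSpace ℝ (Fin n), ℂ), ∫ x, k x * ψ x = ∫ x, f x * (𝓕 ψ) x

/-- Membership in `L̂^p(ℝⁿ) = {f ∈ L^p : f = ĝ for some g ∈ L^{p'}}`, where `1/p + 1/p' = 1`. -/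
def MemHatL {n : ℕ} (p : ℝ≥0∞) (f : EuclideanSpace ℝ (Fin n) → ℂ) : Prop :=
  MemLp f p volume ∧
    ∃ g : EuclideanSpace ℝ (Fin n) → ℂ, MemLp g p.conjExponent volume ∧ IsFourierTransform g f

/-- The norm `‖f‖_{L̂^p} = ‖f̂‖_{p'}`. The transform `f̂` is unique up to null sets, so the infimum
is over a single class of functions; it is `∞` if `f̂` is not a function in `L^{p'}`. -/
def hatLNorm {n : ℕ} (p : ℝ≥0∞) (f : EuclideanSpace ℝ (Fin n) → ℂ) : ℝ≥0∞ :=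
  ⨅ (k : EuclideanSpace ℝ (Fin n) → ℂ)
    (_ : MemLp k p.conjExponent volume ∧ IsFourierTransform f k),
    eLpNorm k p.conjExponent volume

/-- The functional `‖μ‖_p^* = sup |∫ h dμ|` over `h ∈ L̂^{p'}(ℝⁿ)` with `‖h‖_{L̂^{p'}} ≤ 1`.
The measure `μ` may charge Lebesgue null sets, so the value of `∫ h dμ` depends on the
representative of `h`; the supremum is over the `h` with a continuous representative
(among them all the Schwartz functions), integrated by means of it, for which
`∫ h dμ` converges. -/
def starNorm {n : ℕ} (p : ℝ≥0∞) (μ : ComplexMeasure (EuclideanSpace ℝ (Fin n))) : ℝ≥0∞ :=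
  ⨆ (h : EuclideanSpace ℝ (Fin n) → ℂ)
    (_ : Continuous h ∧ MemHatL p.conjExponent h ∧ hatLNorm p.conjExponent h ≤ 1 ∧
      μ.Integrable h),
    ‖cintegral μ h‖ₑ

/-- Membership of a finite complex Borel measure in `𝓜_p`. -/
def MemM {n : ℕ} (p : ℝ≥0∞) (μ : ComplexMeasure (EuclideanSpace ℝ (Fin n))) : Prop :=
  starNorm p μ < ∞

/-- A measure is supported in `F` if it vanishes on the measurable sets that do not meet `F`. -/
def MeasureSupportedIn {n : ℕ} (μ : ComplexMeasure (EuclideanSpace ℝ (Fin n)))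
    (F : Set (EuclideanSpace ℝ (Fin n))) : Prop :=
  ∀ A : Set (EuclideanSpace ℝ (Fin n)), MeasurableSet A → Disjoint A F → μ A = 0

/-- A function is supported in `E` if it vanishes almost everywhere outside `E`. -/
def FunctionSupportedIn {n : ℕ} (u : EuclideanSpace ℝ (Fin n) → ℂ)
    (E : Set (EuclideanSpace ℝ (Fin n))) : Prop :=
  ∀ᵐ y ∂(volume : Measure (EuclideanSpace ℝ (Fin n))), y ∉ E → u y = 0

end MeasureLp

end

open scoped ComplexConjugate

namespace MeasureLp

/-! The proof is Benedicks' periodization argument, carried out for measures. After a dilation, `F`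
has measure less than one, while the set where the transform is nonzero still has finite measure. By
Borel–Cantelli, for almost every `ξ` the coset `ξ + ℤⁿ` meets that set in finitely many points
(`ae_finite_add_latticeVec_mem`).

Fix such a `ξ`, multiply `μ` by the character of frequency `-ξ` and push the result forward to the
torus. The Fourier coefficients of this measure are the values of the transform on `ξ + ℤⁿ`, so only
finitely many are nonzero. By uniqueness of Fourier coefficients the measure is `P dx` with `P` a
trigonometric polynomial. Since `F` has measure less than one, its image misses a subset of the
torus of positive measure, and `P` vanishes almost everywhere there. By analyticity `P = 0`, and its
zeroth coefficient is the transform at `ξ` (`pullTransform_eq_zero_of_finite`). Hence the transform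
vanishes almost everywhere, by continuity everywhere, and `μ = 0` by uniqueness for characters of
`ℝⁿ`.

Both uniqueness statements, on the torus and on `ℝⁿ`, are instances of `DeterminesFiniteMeasures`,
which passes from positive measures to complex densities. -/

/-! ### Uniqueness of complex densities from uniqueness of finite positive measures -/

/-- Integrals against the positive and negative parts of a real density recombine. -/
lemma integral_map_posPart_sub_negPart {X Y : Type*} [MeasurableSpace X] [MeasurableSpace Y]
    {lam : Measure Y} {rho : Y → ℝ} (hrho : Integrable rho lam) {p : Y → X} (hp : Measurable p)
    {f : X → ℂ} (hf : Measurable f) {C : ℝ} (hC : ∀ x, ‖f x‖ ≤ C) :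
    ∫ x, f x ∂((lam.withDensity fun y => ENNReal.ofReal (rho y)).map p) -
      ∫ x, f x ∂((lam.withDensity fun y => ENNReal.ofReal (-rho y)).map p) =
      ∫ y, f (p y) * (rho y : ℂ) ∂lam := by
  have hfp : AEStronglyMeasurable (fun y => f (p y)) lam :=
    (hf.comp hp).aestronglyMeasurable
  rw [integral_map hp.aemeasurable hf.aestronglyMeasurable,
    integral_map hp.aemeasurable hf.aestronglyMeasurable,
    integral_withDensity_eq_integral_toReal_smul₀ hrho.aemeasurable.ennreal_ofReal (by simp),
    integral_withDensity_eq_integral_toReal_smul₀ (f := fun y => ENNReal.ofReal (-rho y))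
      hrho.neg.aemeasurable.ennreal_ofReal (by simp),
    ← integral_sub]
  · refine integral_congr_ae (.of_forall fun y => ?_)
    simp only [ENNReal.toReal_ofReal', ← sub_smul]
    have : max (rho y) 0 - max (-rho y) 0 = rho y := by
      rcases le_total 0 (rho y) with h | h
      · rw [max_eq_left h, max_eq_right (by linarith)]; ring
      · rw [max_eq_right h, max_eq_left (by linarith)]; ring
    rw [this, Complex.real_smul, mul_comm]
  · simp only [ENNReal.toReal_ofReal']
    exact hrho.pos_part.smul_bdd C hfp (.of_forall fun y => hC _)
  · simp only [ENNReal.toReal_ofReal']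
    exact hrho.neg_part.smul_bdd C hfp (.of_forall fun y => hC _)

lemma isFiniteMeasure_map_withDensity_ofReal {X Y : Type*} [MeasurableSpace X] [MeasurableSpace Y]
    {lam : Measure Y} {rho : Y → ℝ} (hrho : Integrable rho lam) (p : Y → X) :
    IsFiniteMeasure ((lam.withDensity fun y => ENNReal.ofReal (rho y)).map p) := by
  have := isFiniteMeasure_withDensity_ofReal hrho.2
  infer_instance

/-- A family of functions that determines finite measures. -/
def DeterminesFiniteMeasures {X : Type*} [MeasurableSpace X] (S : Set (X → ℂ)) : Prop :=
  (∀ f ∈ S, Measurable f ∧ (∃ C : ℝ, ∀ x, ‖f x‖ ≤ C) ∧ (fun x => conj (f x)) ∈ S) ∧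
    ∀ P P' : Measure X, IsFiniteMeasure P → IsFiniteMeasure P' →
      (∀ f ∈ S, ∫ x, f x ∂P = ∫ x, f x ∂P') → P = P'

section

variable {X Y Z : Type*} [MeasurableSpace X] [MeasurableSpace Y] [MeasurableSpace Z]
  {S : Set (X → ℂ)} {lam : Measure Y} {nu : Measure Z} {p : Y → X} {q : Z → X}

/-- Moving the negative parts to the opposite sides turns an identity between signed measures into
one between finite positive measures, to which the determining property applies. -/
lemma DeterminesFiniteMeasures.integral_mul_ofReal_eq (hS : DeterminesFiniteMeasures S)
    {u : Y → ℝ} {v : Z → ℝ} (hu : Integrable u lam) (hv : Integrable v nu)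
    (hp : Measurable p) (hq : Measurable q)
    (h : ∀ f ∈ S, ∫ y, f (p y) * (u y : ℂ) ∂lam = ∫ z, f (q z) * (v z : ℂ) ∂nu)
    {f : X → ℂ} (hf : Measurable f) {C : ℝ} (hC : ∀ x, ‖f x‖ ≤ C) :
    ∫ y, f (p y) * (u y : ℂ) ∂lam = ∫ z, f (q z) * (v z : ℂ) ∂nu := by
  have i1 := isFiniteMeasure_map_withDensity_ofReal hu p
  have i2 := isFiniteMeasure_map_withDensity_ofReal hu.neg p
  have i3 := isFiniteMeasure_map_withDensity_ofReal hv q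
  have i4 := isFiniteMeasure_map_withDensity_ofReal hv.neg q
  simp only [Pi.neg_apply] at i2 i4
  have key := hS.2
    ((lam.withDensity fun y => ENNReal.ofReal (u y)).map p +
      (nu.withDensity fun y => ENNReal.ofReal (-v y)).map q)
    ((nu.withDensity fun y => ENNReal.ofReal (v y)).map q +
      (lam.withDensity fun y => ENNReal.ofReal (-u y)).map p) inferInstance inferInstance ?_
  · have hi : ∀ P : Measure X, IsFiniteMeasure P → Integrable f P := fun P hP =>
      Integrable.of_bound hf.aestronglyMeasurable C (.of_forall hC)
    have e := congrArg (fun P : Measure X => ∫ x, f x ∂P) key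
    rw [integral_add_measure (hi _ i1) (hi _ i4), integral_add_measure (hi _ i3) (hi _ i2)] at e
    rw [← integral_map_posPart_sub_negPart hu hp hf hC,
      ← integral_map_posPart_sub_negPart hv hq hf hC]
    linear_combination e
  · intro g hg
    obtain ⟨gm, ⟨D, hD⟩, -⟩ := hS.1 g hg
    have hi : ∀ P : Measure X, IsFiniteMeasure P → Integrable g P := fun P hP =>
      Integrable.of_bound gm.aestronglyMeasurable D (.of_forall hD)
    have e := h g hg
    rw [← integral_map_posPart_sub_negPart hu hp gm hD,
      ← integral_map_posPart_sub_negPart hv hq gm hD] at e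
    rw [integral_add_measure (hi _ i1) (hi _ i4), integral_add_measure (hi _ i3) (hi _ i2)]
    linear_combination e

lemma integral_mul_conj (f u : Y → ℂ) :
    ∫ y, f y * conj (u y) ∂lam = conj (∫ y, conj (f y) * u y ∂lam) := by
  rw [← integral_conj]
  simp

lemma integral_mul_re {f : Y → ℂ}
    (hf : AEStronglyMeasurable f lam) {C : ℝ} (hC : ∀ x, ‖f x‖ ≤ C) {u : Y → ℂ}
    (hu : Integrable u lam) :
    ∫ y, f y * ((u y).re : ℂ) ∂lam =
      (∫ y, f y * u y ∂lam + conj (∫ y, conj (f y) * u y ∂lam)) / 2 := by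
  have hu' : Integrable (fun y => conj (u y)) lam :=
    Complex.conjCLE.toContinuousLinearMap.integrable_comp hu
  rw [← integral_mul_conj, ← integral_add, ← integral_div]
  · refine integral_congr_ae (.of_forall fun y => ?_)
    simp only
    rw [Complex.re_eq_add_conj]; ring
  · exact hu.bdd_mul hf (.of_forall hC)
  · exact hu'.bdd_mul hf (.of_forall hC)

/-- Taking the real part of a density involves testing with the conjugate of `f` as well; this is
why a determining family is required to be closed under conjugation. -/
lemma DeterminesFiniteMeasures.integral_mul_re_eq (hS : DeterminesFiniteMeasures S)
    {u : Y → ℂ} {v : Z → ℂ} (hu : Integrable u lam) (hv : Integrable v nu)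
    (hp : Measurable p) (hq : Measurable q)
    (h : ∀ f ∈ S, ∫ y, f (p y) * u y ∂lam = ∫ z, f (q z) * v z ∂nu)
    {f : X → ℂ} (hf : Measurable f) {C : ℝ} (hC : ∀ x, ‖f x‖ ≤ C) :
    ∫ y, f (p y) * ((u y).re : ℂ) ∂lam = ∫ z, f (q z) * ((v z).re : ℂ) ∂nu := by
  refine hS.integral_mul_ofReal_eq hu.re hv.re hp hq (fun g hg => ?_) hf hC
  obtain ⟨gm, ⟨D, hD⟩, hg'⟩ := hS.1 g hg
  have e1 := integral_mul_re (gm.comp hp).aestronglyMeasurable (fun y => hD (p y)) hu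
  have e2 := integral_mul_re (gm.comp hq).aestronglyMeasurable (fun y => hD (q y)) hv
  simp only [Function.comp_apply] at e1 e2
  simp only [RCLike.re_eq_complex_re]
  rw [e1, e2, h g hg, h _ hg']

lemma setIntegral_preimage_eq_re_add_im {r : Y → X} {t : Y → ℂ}
    (ht : Integrable t lam) (hr : Measurable r) {B : Set X} (hB : MeasurableSet B) :
    ∫ y in r ⁻¹' B, t y ∂lam =
      ∫ y, B.indicator (fun _ => (1 : ℂ)) (r y) * ((t y).re : ℂ) ∂lam +
      Complex.I * ∫ y, B.indicator (fun _ => (1 : ℂ)) (r y) *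
        ((-Complex.I * t y).re : ℂ) ∂lam := by
  have hC : ∀ x, ‖B.indicator (fun _ => (1 : ℂ)) x‖ ≤ 1 := fun x =>
    (norm_indicator_le_norm_self _ _).trans (by simp)
  have hm : AEStronglyMeasurable (fun y => B.indicator (fun _ => (1 : ℂ)) (r y)) lam :=
    ((measurable_const.indicator hB).comp hr).aestronglyMeasurable
  rw [← integral_const_mul, ← integral_add, ← integral_indicator (hr hB)]
  · refine integral_congr_ae (.of_forall fun y => ?_)
    by_cases hy : r y ∈ B
    · simp [Set.indicator, hy, mul_comm Complex.I, Complex.re_add_im]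
    · simp [Set.indicator, hy]
  · exact ht.re.ofReal.bdd_mul hm (.of_forall fun y => hC _)
  · exact ((ht.const_mul (-Complex.I)).re.ofReal.bdd_mul hm
      (.of_forall fun y => hC _)).const_mul _

/-- Complex densities are determined by testing against a determining family. -/
lemma DeterminesFiniteMeasures.setIntegral_preimage_eq (hS : DeterminesFiniteMeasures S)
    {u : Y → ℂ} {v : Z → ℂ} (hu : Integrable u lam) (hv : Integrable v nu)
    (hp : Measurable p) (hq : Measurable q)
    (h : ∀ f ∈ S, ∫ y, f (p y) * u y ∂lam = ∫ z, f (q z) * v z ∂nu)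
    {B : Set X} (hB : MeasurableSet B) :
    ∫ y in p ⁻¹' B, u y ∂lam = ∫ z in q ⁻¹' B, v z ∂nu := by
  have hf : Measurable (B.indicator (fun _ => (1 : ℂ))) := measurable_const.indicator hB
  have hC : ∀ x, ‖B.indicator (fun _ => (1 : ℂ)) x‖ ≤ 1 := fun x =>
    (norm_indicator_le_norm_self _ _).trans (by simp)
  have hre := hS.integral_mul_re_eq hu hv hp hq h hf hC
  -- The imaginary part of a density is the real part of its product with `-i`.
  have him := hS.integral_mul_re_eq (hu.const_mul (-Complex.I)) (hv.const_mul (-Complex.I)) hp hq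
    (fun f hf => by
      simp only [mul_left_comm _ (-Complex.I), integral_const_mul, h f hf]) hf hC
  rw [setIntegral_preimage_eq_re_add_im hu hp hB, setIntegral_preimage_eq_re_add_im hv hq hB,
    hre, him]

end

/-! ### Complex measures as densities against their variation -/

/-- A complex measure is its Radon-Nikodym derivative times its variation. -/
lemma exists_density_variation {X : Type*} [MeasurableSpace X] (μ : ComplexMeasure X) :
    ∃ (lam : Measure X) (w : X → ℂ), lam = μ.variation ∧ IsFiniteMeasure lam ∧
      Integrable w lam ∧ (∀ᵐ x ∂lam, ‖w x‖ ≤ 1) ∧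
      ∀ A, MeasurableSet A → μ A = ∫ x in A, w x ∂lam := by
  have hfin : IsFiniteMeasure μ.variation := by
    have hle : μ.variation ≤ (ComplexMeasure.re μ).totalVariation +
        (ComplexMeasure.im μ).totalVariation := by
      refine VectorMeasure.variation_le_of_forall_enorm_le fun A hA => ?_
      have e : μ A = ((ComplexMeasure.re μ A : ℝ) : ℂ) +
          ((ComplexMeasure.im μ A : ℝ) : ℂ) * Complex.I := by
        exact (Complex.re_add_im _).symm
      rw [e]
      refine (enorm_add_le _ _).trans ?_
      have h1 := (ComplexMeasure.re μ).enorm_le_totalVariation A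
      have h2 := (ComplexMeasure.im μ).enorm_le_totalVariation A
      rw [enorm_mul]
      simpa [← ofReal_norm] using add_le_add h1 h2
    exact isFiniteMeasure_of_le _ hle
  have hac : ∀ A, μ.variation A = 0 → μ A = 0 := fun A hA => by
    have := μ.enorm_measure_le_variation A
    rw [hA] at this
    simpa using this
  have hre : ComplexMeasure.re μ ≪ᵥ μ.variation.toENNRealVectorMeasure := by
    refine VectorMeasure.AbsolutelyContinuous.mk fun A hA h0 => ?_
    rw [Measure.toENNRealVectorMeasure_apply_measurable hA] at h0
    exact congrArg Complex.re (hac A h0)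
  have him : ComplexMeasure.im μ ≪ᵥ μ.variation.toENNRealVectorMeasure := by
    refine VectorMeasure.AbsolutelyContinuous.mk fun A hA h0 => ?_
    rw [Measure.toENNRealVectorMeasure_apply_measurable hA] at h0
    exact congrArg Complex.im (hac A h0)
  have ire := (ComplexMeasure.re μ).integrable_rnDeriv μ.variation
  have iim := (ComplexMeasure.im μ).integrable_rnDeriv μ.variation
  have ere := SignedMeasure.withDensityᵥ_rnDeriv_eq _ _ hre
  have eim := SignedMeasure.withDensityᵥ_rnDeriv_eq _ _ him
  set w : X → ℂ := fun x => (((ComplexMeasure.re μ).rnDeriv μ.variation x : ℝ) : ℂ) +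
    (((ComplexMeasure.im μ).rnDeriv μ.variation x : ℝ) : ℂ) * Complex.I with hw
  have iw : Integrable w μ.variation := ire.ofReal.add (iim.ofReal.mul_const _)
  have hμ : ∀ A, MeasurableSet A → μ A = ∫ x in A, w x ∂μ.variation := by
    intro A hA
    have e1 := congrArg (fun s : SignedMeasure X => s A) ere
    have e2 := congrArg (fun s : SignedMeasure X => s A) eim
    simp only [withDensityᵥ_apply ire hA, withDensityᵥ_apply iim hA] at e1 e2
    rw [hw, integral_add ire.integrableOn.ofReal (iim.integrableOn.ofReal.mul_const _),
      integral_mul_const, integral_complex_ofReal, integral_complex_ofReal, e1, e2]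
    exact (Complex.re_add_im _).symm
  refine ⟨_, w, rfl, hfin, iw, ?_, hμ⟩
  -- The variation of `w dλ` is `|w| dλ`; here it is `λ` itself, so `|w| = 1` almost everywhere.
  have hv : μ.variation.withDensityᵥ w = μ := by
    ext A hA
    rw [withDensityᵥ_apply iw hA, hμ A hA]
  have h1 := Measure.variation_withDensityᵥ iw
  rw [hv] at h1
  have h2 : μ.variation.withDensity (fun x => ‖w x‖ₑ) = μ.variation.withDensity 1 := by
    rw [← h1, withDensity_one]
  have h3 := (withDensity_eq_iff_of_sigmaFinite iw.aestronglyMeasurable.enorm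
    aemeasurable_one).1 h2
  filter_upwards [h3] with x hx
  have : ‖w x‖ₑ = 1 := hx
  rw [← ofReal_norm, ENNReal.ofReal_eq_one] at this
  exact this.le

/-- Integration against a complex measure in terms of a bounded density. -/
lemma cintegral_eq_integral_mul {n : ℕ} {μ : ComplexMeasure (EuclideanSpace ℝ (Fin n))}
    {w : EuclideanSpace ℝ (Fin n) → ℂ} (hw : Integrable w μ.variation)
    (hw1 : ∀ᵐ x ∂μ.variation, ‖w x‖ ≤ 1)
    (hμ : ∀ A, MeasurableSet A → μ A = ∫ x in A, w x ∂μ.variation)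
    {h : EuclideanSpace ℝ (Fin n) → ℂ} (hh : Integrable h μ.variation) :
    cintegral μ h = ∫ x, h x * w x ∂μ.variation := by
  have hb : ∀ {f : EuclideanSpace ℝ (Fin n) → ℂ}, Integrable f μ.variation →
      Integrable (fun x => f x * w x) μ.variation := fun hf =>
    hf.mul_bdd hw.aestronglyMeasurable hw1
  unfold cintegral
  refine Integrable.induction
    (fun h => ∫ᵛ x, h x ∂[ContinuousLinearMap.mul ℝ ℂ; μ] = ∫ x, h x * w x ∂μ.variation)
    ?_ ?_ ?_ ?_ hh
  · intro c s hs hfin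
    rw [VectorMeasure.integral_eq_setToFun, setToFun_indicator_const _ hs hfin.ne]
    have : ∀ x, s.indicator (fun _ => c) x * w x = s.indicator (fun x => c * w x) x := by
      intro x
      by_cases hx : x ∈ s <;> simp [hx]
    simp only [this]
    rw [integral_indicator hs, integral_const_mul, ← hμ s hs]
    rfl
  · intro f g _ hf hg hf' hg'
    rw [VectorMeasure.integral_add hf hg, hf', hg', ← integral_add (hb hf) (hb hg)]
    simp [add_mul]
  -- Both sides are continuous in the L¹ norm, the right one because `|w| ≤ 1`.
  · refine isClosed_eq VectorMeasure.continuous_integral ?_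
    refine continuous_iff_continuousAt.2 fun f => ?_
    refine tendsto_integral_of_L1 _ (hb (L1.integrable_coeFn f)).aestronglyMeasurable
      (.of_forall fun g => hb (L1.integrable_coeFn g)) ?_
    have ht : Filter.Tendsto (fun g : Lp ℂ 1 μ.variation => ‖g - f‖ₑ) (nhds f) (nhds 0) := by
      have : Continuous (fun g : Lp ℂ 1 μ.variation => ‖g - f‖ₑ) := by fun_prop
      simpa using this.tendsto f
    refine tendsto_of_tendsto_of_tendsto_of_le_of_le tendsto_const_nhds ht
      (fun _ => zero_le) fun g => ?_
    simp only
    rw [Lp.enorm_def, eLpNorm_one_eq_lintegral_enorm]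
    refine lintegral_mono_ae ?_
    filter_upwards [Lp.coeFn_sub g f, hw1] with x hx hx1
    rw [← sub_mul, hx, enorm_mul, Pi.sub_apply]
    refine mul_le_of_le_one_right' ?_
    rw [← ofReal_norm]
    exact ENNReal.ofReal_le_one.2 hx1
  · intro f g hfg hf hf'
    rw [← VectorMeasure.integral_congr_ae hfg, hf']
    exact integral_congr_ae (by filter_upwards [hfg] with x hx; rw [hx])

/-! ### Zero sets of real-analytic functions -/

/-- A real-analytic function on the line that vanishes on a set of positive measure is zero. -/
lemma eq_zero_of_analyticOnNhd_of_volume_ne_zero {f : ℝ → ℂ} (hf : AnalyticOnNhd ℝ f Set.univ)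
    (h : volume {t | f t = 0} ≠ 0) (t : ℝ) : f t = 0 := by
  rcases hf.eqOn_zero_or_eventually_ne_zero_of_preconnected isPreconnected_univ with h0 | h0
  · exact h0 (Set.mem_univ t)
  -- If `f` is not identically zero, its nonzero set is codiscrete, hence of full measure.
  · have := ae_restrict_le_codiscreteWithin (μ := volume) MeasurableSet.univ h0
    rw [Measure.restrict_univ, mem_ae_iff] at this
    exact absurd (by simpa [Set.compl_def] using this) h

/-- A continuous, separately real-analytic function on `ℝⁿ` that vanishes on a set of positive
measure is zero. -/
lemma eq_zero_of_separately_analytic_of_volume_ne_zero {n : ℕ} {f : (Fin n → ℝ) → ℂ}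
    (hc : Continuous f)
    (hf : ∀ i x, AnalyticOnNhd ℝ (fun t => f (Function.update x i t)) Set.univ)
    (h : volume {x | f x = 0} ≠ 0) (x : Fin n → ℝ) : f x = 0 := by
  induction n with
  | zero =>
    obtain ⟨y, hy⟩ := nonempty_of_measure_ne_zero h
    rwa [Subsingleton.elim x y]
  | succ n ih =>
    have hcons : Continuous fun p : ℝ × (Fin n → ℝ) => f (Fin.cons p.1 p.2) := by
      refine hc.comp (continuous_pi fun i => ?_)
      refine Fin.cases ?_ (fun j => ?_) i
      · simpa using continuous_fst
      · simpa [Function.comp_def] using (continuous_apply j).comp continuous_snd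
    have hmp := (volume_preserving_piFinSuccAbove (fun _ : Fin (n + 1) => ℝ) 0).symm
    have hZ : MeasurableSet {x | f x = 0} := (isClosed_singleton.preimage hc).measurableSet
    have hZ' : MeasurableSet {p : ℝ × (Fin n → ℝ) | f (Fin.cons p.1 p.2) = 0} :=
      (isClosed_singleton.preimage hcons).measurableSet
    have e : volume {p : ℝ × (Fin n → ℝ) | f (Fin.cons p.1 p.2) = 0} = volume {x | f x = 0} := by
      rw [← hmp.measure_preimage hZ.nullMeasurableSet]
      congr 1
      ext p
      simp [MeasurableEquiv.piFinSuccAbove, Fin.insertNthEquiv]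
    rw [← e, Measure.volume_eq_prod, Ne, Measure.measure_prod_null hZ'] at h
    -- By Fubini a non-null set of `t` has a non-null zero slice, and by induction `f` vanishes on
    -- each such slice entirely. For fixed `y` the one-variable case in `t` then applies.
    have hW : volume {t : ℝ | ∀ y : Fin n → ℝ, f (Fin.cons t y) = 0} ≠ 0 := by
      intro h0
      refine h ?_
      filter_upwards [measure_eq_zero_iff_ae_notMem.1 h0] with t ht
      by_contra hne
      refine ht fun y => ?_
      refine ih (f := fun y => f (Fin.cons t y))
        (hcons.comp (by fun_prop : Continuous fun y : Fin n → ℝ => (t, y)))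
        (fun i y => ?_) hne y
      simpa [Fin.cons_update] using hf i.succ (Fin.cons t y)
    have hall : ∀ t y, f (Fin.cons t y) = 0 := by
      intro t y
      refine eq_zero_of_analyticOnNhd_of_volume_ne_zero (f := fun t => f (Fin.cons t y)) ?_
        (fun h0 => hW (measure_mono_null (fun t ht => ht y) h0)) t
      simpa [Fin.update_cons_zero] using hf 0 (Fin.cons 0 y)
    rw [← Fin.cons_self_tail x]
    exact hall _ _

/-! ### Lattice cosets and sets of finite measure -/

/-- The unit cube, a fundamental domain of `ℤⁿ`. -/
def unitCube (n : ℕ) : Set (Fin n → ℝ) := Set.univ.pi fun _ => Set.Ioc 0 1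

/-- The lattice vector with integer coordinates `m`. -/
def latticeVec {n : ℕ} (m : Fin n → ℤ) : Fin n → ℝ := fun i => m i

lemma latticeVec_add {n : ℕ} (m k : Fin n → ℤ) :
    latticeVec (m + k) = latticeVec m + latticeVec k := by
  ext i; simp [latticeVec]

lemma measurableSet_unitCube (n : ℕ) : MeasurableSet (unitCube n) :=
  MeasurableSet.univ_pi fun _ => measurableSet_Ioc

lemma volume_unitCube (n : ℕ) : volume (unitCube n) = 1 := by
  simp [unitCube, volume_pi_pi]

lemma exists_add_latticeVec_mem_unitCube {n : ℕ} (x : Fin n → ℝ) :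
    ∃ k, x + latticeVec k ∈ unitCube n := by
  refine ⟨fun i => 1 - ⌈x i⌉, fun i _ => ?_⟩
  have h1 := Int.le_ceil (x i)
  have h2 := Int.ceil_lt_add_one (x i)
  simp only [latticeVec, Pi.add_apply, Set.mem_Ioc]
  push_cast
  constructor <;> linarith

lemma latticeVec_eq_zero_of_mem_unitCube {n : ℕ} {x : Fin n → ℝ} {k : Fin n → ℤ}
    (hx : x ∈ unitCube n) (hxk : x + latticeVec k ∈ unitCube n) : k = 0 := by
  ext i
  have h1 := hx i trivial
  have h2 := hxk i trivial
  simp only [latticeVec, Pi.add_apply, Set.mem_Ioc] at h1 h2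
  have h3 : (-1 : ℝ) < k i := by linarith
  have h4 : (k i : ℝ) < 1 := by linarith
  have h5 : (-1 : ℤ) < k i := by exact_mod_cast h3
  have h6 : k i < (1 : ℤ) := by exact_mod_cast h4
  simp only [Pi.zero_apply]
  omega

/-- Integer translates of a set cover the unit cube with total measure at most its measure. -/
lemma tsum_volume_translate_inter_unitCube_le {n : ℕ} {A : Set (Fin n → ℝ)}
    (hA : MeasurableSet A) :
    ∑' m : Fin n → ℤ, volume ((fun x => x + latticeVec m) ⁻¹' A ∩ unitCube n) ≤ volume A := by
  -- Translation by `m` carries each piece into `A ∩ (cube + m)`, and these sets are disjoint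
  -- subsets of `A`.
  have e : ∀ m : Fin n → ℤ, volume ((fun x => x + latticeVec m) ⁻¹' A ∩ unitCube n) =
      volume (A ∩ (fun x => x + latticeVec (-m)) ⁻¹' unitCube n) := by
    intro m
    rw [← measure_preimage_add_right volume (latticeVec m)
      (A ∩ (fun x => x + latticeVec (-m)) ⁻¹' unitCube n)]
    congr 1
    ext x
    simp [add_assoc, ← latticeVec_add, show latticeVec (0 : Fin n → ℤ) = 0 by ext; simp [latticeVec]]
  simp only [e]
  rw [← measure_iUnion]
  · exact measure_mono (Set.iUnion_subset fun m => Set.inter_subset_left)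
  · intro m k hmk
    refine Set.disjoint_left.2 fun x hx hx' => hmk ?_
    have := latticeVec_eq_zero_of_mem_unitCube (k := m - k) hx.2 (by
      rw [add_assoc, ← latticeVec_add, show -m + (m - k) = -k by abel]
      exact hx'.2)
    exact sub_eq_zero.1 this
  · exact fun m => hA.inter ((measurable_add_const _) (measurableSet_unitCube n))

/-- Almost every coset of `ℤⁿ` meets a set of finite measure in finitely many points. -/
lemma ae_finite_add_latticeVec_mem {n : ℕ} {A : Set (Fin n → ℝ)} (hA : MeasurableSet A)
    (hfin : volume A ≠ ∞) :
    ∀ᵐ x : Fin n → ℝ, {m : Fin n → ℤ | x + latticeVec m ∈ A}.Finite := by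
  have h1 : ∀ᵐ x ∂(volume.restrict (unitCube n)),
      {m : Fin n → ℤ | x ∈ (fun x => x + latticeVec m) ⁻¹' A}.Finite := by
    -- Borel–Cantelli on the cube: the measures of the translates have finite sum.
    refine ae_finite_setOfPred_mem (ne_top_of_le_ne_top hfin ?_)
    refine le_trans (le_of_eq ?_) (tsum_volume_translate_inter_unitCube_le hA)
    refine tsum_congr fun m => ?_
    rw [Measure.restrict_apply ((measurable_add_const _) hA)]
  rw [ae_restrict_iff' (measurableSet_unitCube n)] at h1
  -- Finiteness depends only on the coset, so it transfers from the cube to all of `ℝⁿ`.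
  have h2 : ∀ k : Fin n → ℤ, ∀ᵐ x : Fin n → ℝ, x + latticeVec k ∈ unitCube n →
      {m : Fin n → ℤ | x + latticeVec k + latticeVec m ∈ A}.Finite := fun k =>
    (measurePreserving_add_right volume (latticeVec k)).quasiMeasurePreserving.ae h1
  rw [← ae_all_iff] at h2
  filter_upwards [h2] with x hx
  obtain ⟨k, hk⟩ := exists_add_latticeVec_mem_unitCube x
  refine ((hx k hk).image (k + ·)).subset fun m hm => ⟨m - k, ?_, by simp⟩
  simpa [add_assoc, ← latticeVec_add] using hm

/-- A set of measure less than one misses a whole coset of `ℤⁿ` for a non-null set of points of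
the unit cube. -/
lemma volume_unitCube_avoiding_ne_zero {n : ℕ} {F : Set (Fin n → ℝ)} (hF : MeasurableSet F)
    (h1 : volume F < 1) :
    volume {x ∈ unitCube n | ∀ m : Fin n → ℤ, x + latticeVec m ∉ F} ≠ 0 := by
  intro h0
  -- If the avoiding set were null, the translates of `F` would cover almost all of the cube,
  -- forcing `volume F ≥ 1`.
  have hsub : unitCube n ⊆ {x ∈ unitCube n | ∀ m : Fin n → ℤ, x + latticeVec m ∉ F} ∪
      ⋃ m : Fin n → ℤ, ((fun x => x + latticeVec m) ⁻¹' F ∩ unitCube n) := by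
    intro x hx
    by_cases h : ∀ m : Fin n → ℤ, x + latticeVec m ∉ F
    · exact Or.inl ⟨hx, h⟩
    · push Not at h
      obtain ⟨m, hm⟩ := h
      exact Or.inr (Set.mem_iUnion.2 ⟨m, hm, hx⟩)
  have := (measure_mono (μ := volume) hsub).trans (measure_union_le _ _)
  rw [volume_unitCube, h0, zero_add] at this
  exact absurd h1 (not_lt.2 (this.trans ((measure_iUnion_le _).trans
    (tsum_volume_translate_inter_unitCube_le hF))))

lemma measurableSet_unitCube_avoiding {n : ℕ} {F : Set (Fin n → ℝ)} (hF : MeasurableSet F) :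
    MeasurableSet {x ∈ unitCube n | ∀ m : Fin n → ℤ, x + latticeVec m ∉ F} := by
  have : {x | ∀ m : Fin n → ℤ, x + latticeVec m ∉ F} =
      ⋂ m : Fin n → ℤ, ((fun x => x + latticeVec m) ⁻¹' F)ᶜ := by ext; simp
  refine (measurableSet_unitCube n).inter (s₂ := {x | ∀ m : Fin n → ℤ, x + latticeVec m ∉ F}) ?_
  rw [this]
  exact MeasurableSet.iInter fun m => ((measurable_add_const _) hF).compl

/-! ### Characters of the torus and trigonometric polynomials -/

/-- The projection of `ℝⁿ` to the torus. -/
def toTorus {n : ℕ} (x : Fin n → ℝ) : UnitAddTorus (Fin n) := fun i => (x i : UnitAddCircle)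

lemma measurable_toTorus {n : ℕ} : Measurable (toTorus (n := n)) :=
  measurable_pi_lambda _ fun i => AddCircle.measurable_mk'.comp (measurable_pi_apply i)

lemma mFourier_toTorus {n : ℕ} (m : Fin n → ℤ) (x : Fin n → ℝ) :
    UnitAddTorus.mFourier m (toTorus x) =
      Complex.exp (2 * Real.pi * Complex.I * ((∑ i, m i * x i : ℝ) : ℂ)) := by
  simp only [UnitAddTorus.mFourier, ContinuousMap.coe_mk, toTorus, fourier_coe_apply]
  rw [← Complex.exp_sum]
  congr 1
  push_cast
  rw [Finset.mul_sum]
  refine Finset.sum_congr rfl fun i _ => ?_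
  simp
  ring

/-- The characters of the torus determine finite measures. -/
lemma determinesFiniteMeasures_mFourier (n : ℕ) :
    DeterminesFiniteMeasures (X := UnitAddTorus (Fin n))
      (Set.range fun m : Fin n → ℤ => ⇑(UnitAddTorus.mFourier m)) := by
  refine ⟨?_, fun P P' hP hP' h => ?_⟩
  · rintro _ ⟨m, rfl⟩
    refine ⟨(UnitAddTorus.mFourier m).continuous.measurable, ⟨‖UnitAddTorus.mFourier m‖,
      fun x => ContinuousMap.norm_coe_le_norm _ x⟩, ⟨-m, ?_⟩⟩
    ext x
    simp [UnitAddTorus.mFourier_neg]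
  -- Stone–Weierstrass: the span of the characters is a star subalgebra separating points, and
  -- equality of integrals extends linearly from the characters to it.
  · refine ext_of_forall_mem_subalgebra_integral_eq_of_pseudoEMetric_complete_countable (𝕜 := ℂ)
      (A := (UnitAddTorus.mFourierSubalgebra (Fin n)).comap
        (BoundedContinuousFunction.toContinuousMapStarₐ ℂ)) ?_ ?_
    · intro x y hxy
      obtain ⟨_, ⟨f, hf, rfl⟩, hne⟩ := UnitAddTorus.mFourierSubalgebra_separatesPoints hxy
      exact ⟨f, ⟨f, ⟨BoundedContinuousFunction.mkOfCompact f, hf, rfl⟩, rfl⟩, hne⟩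
    · intro g hg
      have hg' : (g : C(UnitAddTorus (Fin n), ℂ)) ∈
          Submodule.span ℂ (Set.range (UnitAddTorus.mFourier (d := Fin n))) := by
        rw [← UnitAddTorus.mFourierSubalgebra_coe]
        exact hg
      have hi : ∀ (f : C(UnitAddTorus (Fin n), ℂ)) (R : Measure (UnitAddTorus (Fin n))),
          IsFiniteMeasure R → Integrable f R := fun f R hR =>
        Integrable.of_bound f.continuous.aestronglyMeasurable ‖f‖
          (.of_forall fun x => f.norm_coe_le_norm x)
      change ∫ x, (g : C(UnitAddTorus (Fin n), ℂ)) x ∂P =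
        ∫ x, (g : C(UnitAddTorus (Fin n), ℂ)) x ∂P'
      generalize (g : C(UnitAddTorus (Fin n), ℂ)) = g' at hg'
      induction hg' using Submodule.span_induction with
      | mem f hf =>
        obtain ⟨m, rfl⟩ := hf
        exact h _ ⟨m, rfl⟩
      | zero => simp
      | add f f' _ _ hf hf' =>
        simp only [ContinuousMap.add_apply]
        rw [integral_add (hi f P hP) (hi f' P hP), integral_add (hi f P' hP') (hi f' P' hP'),
          hf, hf']
      | smul c f _ hf =>
        simp only [ContinuousMap.smul_apply, integral_smul, hf]

/-- Orthogonality of the characters over the unit cube. -/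
lemma setIntegral_unitCube_mFourier {n : ℕ} (m : Fin n → ℤ) :
    ∫ x in unitCube n, UnitAddTorus.mFourier m (toTorus x) = if m = 0 then 1 else 0 := by
  rw [unitCube, volume_pi, Measure.restrict_pi_pi]
  simp only [UnitAddTorus.mFourier, ContinuousMap.coe_mk, toTorus]
  rw [integral_fintype_prod_eq_prod (fun i (t : ℝ) => fourier (m i) (t : UnitAddCircle))]
  have h1 : ∀ k : ℤ, ∫ t in Set.Ioc (0 : ℝ) 1, fourier k (t : UnitAddCircle) =
      if k = 0 then (1 : ℂ) else 0 := by
    intro k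
    rw [← intervalIntegral.integral_of_le zero_le_one]
    simp only [fourier_coe_apply]
    split_ifs with hk
    · simp [hk]
    · have hne : (2 * Real.pi * Complex.I * k : ℂ) ≠ 0 := by
        simp [Real.pi_ne_zero, Complex.I_ne_zero, hk]
      have := integral_exp_mul_complex (a := 0) (b := 1) hne
      simp only [Complex.ofReal_one, div_one]
      rw [this, mul_comm _ (k : ℂ)]
      simp [Complex.exp_int_mul_two_pi_mul_I]
  simp only [h1]
  split_ifs with hm
  · simp [hm]
  · obtain ⟨i, hi⟩ := Function.ne_iff.1 hm
    exact Finset.prod_eq_zero (Finset.mem_univ i) (by simpa using hi)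

/-- The representative in the unit cube of a point of the torus. -/
noncomputable def cubeRep {n : ℕ} (t : UnitAddTorus (Fin n)) : Fin n → ℝ := fun i =>
  AddCircle.measurableEquivIoc 1 0 (t i)

lemma measurable_cubeRep {n : ℕ} : Measurable (cubeRep (n := n)) :=
  measurable_pi_lambda _ fun i =>
    measurable_subtype_coe.comp ((AddCircle.measurableEquivIoc 1 0).measurable.comp
      (measurable_pi_apply i))

lemma cubeRep_mem_unitCube {n : ℕ} (t : UnitAddTorus (Fin n)) : cubeRep t ∈ unitCube n :=
  fun i _ => by simpa [cubeRep] using (AddCircle.measurableEquivIoc (1 : ℝ) 0 (t i)).2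

lemma exists_eq_cubeRep_add_latticeVec {n : ℕ} (x : Fin n → ℝ) :
    ∃ k, x = cubeRep (toTorus x) + latticeVec k := by
  have h : ∀ i, ∃ k : ℤ, x i = cubeRep (toTorus x) i + k := by
    intro i
    have : ((cubeRep (toTorus x) i : ℝ) : UnitAddCircle) = (x i : UnitAddCircle) :=
      AddCircle.coe_equivIoc (p := (1 : ℝ)) (a := 0) (y := (x i : UnitAddCircle))
    rw [← sub_eq_zero, ← AddCircle.coe_sub, AddCircle.coe_eq_zero_iff] at this
    obtain ⟨k, hk⟩ := this
    refine ⟨-k, ?_⟩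
    rw [zsmul_one] at hk
    push_cast
    linarith
  choose k hk using h
  exact ⟨k, funext hk⟩

lemma cubeRep_toTorus {n : ℕ} {x : Fin n → ℝ} (hx : x ∈ unitCube n) :
    cubeRep (toTorus x) = x := by
  obtain ⟨k, hk⟩ := exists_eq_cubeRep_add_latticeVec x
  have := latticeVec_eq_zero_of_mem_unitCube (cubeRep_mem_unitCube (toTorus x)) (hk ▸ hx)
  rw [this] at hk
  ext i
  simpa [latticeVec] using (congrFun hk i).symm

/-- A trigonometric polynomial on `ℝⁿ` that vanishes on a set of positive measure is zero. -/
lemma trigPolynomial_eq_zero {n : ℕ} (S : Finset (Fin n → ℤ)) (a : (Fin n → ℤ) → ℂ)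
    (h : volume {x : Fin n → ℝ | ∑ m ∈ S, a m * UnitAddTorus.mFourier m (toTorus x) = 0} ≠ 0)
    (x : Fin n → ℝ) : ∑ m ∈ S, a m * UnitAddTorus.mFourier m (toTorus x) = 0 := by
  refine eq_zero_of_separately_analytic_of_volume_ne_zero
    (f := fun x => ∑ m ∈ S, a m * UnitAddTorus.mFourier m (toTorus x)) ?_ (fun i x => ?_) h x
  · simp only [mFourier_toTorus]
    fun_prop
  · simp only [mFourier_toTorus]
    intro t _
    have hu : ∀ j, AnalyticAt ℝ (fun t : ℝ => Function.update x i t j) t := by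
      intro j
      by_cases hj : j = i
      · subst hj; simpa using! analyticAt_id (𝕜 := ℝ)
      · simpa [hj] using analyticAt_const
    refine Finset.analyticAt_fun_sum _ fun m _ => analyticAt_const.mul ?_
    refine (analyticAt_cexp.restrictScalars (𝕜 := ℝ)).fun_comp ?_
    have hsum : AnalyticAt ℝ (fun t : ℝ => ∑ j, (m j : ℝ) * Function.update x i t j) t :=
      Finset.analyticAt_fun_sum _ fun j _ => analyticAt_const.mul (hu j)
    exact analyticAt_const.mul ((Complex.ofRealCLM.analyticAt _).fun_comp hsum)

/-! ### Periodization and Benedicks' argument -/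

/-- The transform of a density on `Y` along a map to `ℝⁿ`. -/
noncomputable def pullTransform {Y : Type*} [MeasurableSpace Y] {n : ℕ} (lam : Measure Y) (w : Y → ℂ)
    (p : Y → Fin n → ℝ) (ξ : Fin n → ℝ) : ℂ :=
  ∫ y, Complex.exp (-2 * Real.pi * Complex.I * ((∑ i, ξ i * p y i : ℝ) : ℂ)) * w y ∂lam

lemma norm_exp_character (r : ℝ) : ‖Complex.exp (-2 * Real.pi * Complex.I * (r : ℂ))‖ = 1 := by
  rw [show (-2 * Real.pi * Complex.I * (r : ℂ)) = ((-2 * Real.pi * r : ℝ) : ℂ) * Complex.I by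
    push_cast; ring]
  exact Complex.norm_exp_ofReal_mul_I _

section

variable {Y : Type*} [MeasurableSpace Y] {n : ℕ} {lam : Measure Y} {w : Y → ℂ}
  {p : Y → Fin n → ℝ}

lemma integrable_character_mul (hw : Integrable w lam) (hp : Measurable p) (ξ : Fin n → ℝ) :
    Integrable (fun y => Complex.exp (-2 * Real.pi * Complex.I *
      ((∑ i, ξ i * p y i : ℝ) : ℂ)) * w y) lam := by
  refine hw.bdd_mul (c := 1) ?_ (.of_forall fun y => (norm_exp_character _).le)
  have : ∀ i, Measurable fun y => p y i := fun i => (measurable_pi_apply i).comp hp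
  exact Measurable.aestronglyMeasurable (by fun_prop)

/-- A torus character only shifts the frequency, so the coefficients of the pushed-forward measure
sample the transform on the coset of `ξ`. The sign of `k` flips because the transform carries a
minus sign in the exponent. -/
lemma integral_mFourier_mul_character (k : Fin n → ℤ) (ξ : Fin n → ℝ) :
    ∫ y, UnitAddTorus.mFourier k (toTorus (p y)) * (Complex.exp (-2 * Real.pi * Complex.I *
      ((∑ i, ξ i * p y i : ℝ) : ℂ)) * w y) ∂lam = pullTransform lam w p (ξ + latticeVec (-k)) := by
  unfold pullTransform
  congr 1
  ext y
  rw [mFourier_toTorus, ← mul_assoc, ← Complex.exp_add]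
  congr 2
  have : ∑ i, (ξ + latticeVec (-k)) i * p y i = ∑ i, ξ i * p y i - ∑ i, k i * p y i := by
    rw [← Finset.sum_sub_distrib]
    refine Finset.sum_congr rfl fun i _ => ?_
    simp [latticeVec]
    ring
  rw [this]
  push_cast
  ring

lemma setIntegral_unitCube_mFourier_mul_trigPolynomial (S : Finset (Fin n → ℤ))
    (a : (Fin n → ℤ) → ℂ) (k : Fin n → ℤ) :
    ∫ x in unitCube n, UnitAddTorus.mFourier k (toTorus x) *
      ∑ m ∈ S, a m * UnitAddTorus.mFourier m (toTorus x) = if -k ∈ S then a (-k) else 0 := by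
  have hfin : IsFiniteMeasure (volume.restrict (unitCube n)) :=
    ⟨by simp [volume_unitCube]⟩
  have hi : ∀ m : Fin n → ℤ, Integrable (fun x => UnitAddTorus.mFourier m (toTorus x))
      (volume.restrict (unitCube n)) := fun m =>
    Integrable.of_bound ((UnitAddTorus.mFourier m).continuous.measurable.comp
      measurable_toTorus).aestronglyMeasurable ‖UnitAddTorus.mFourier m‖
      (.of_forall fun x => ContinuousMap.norm_coe_le_norm _ _)
  have e : ∀ x : Fin n → ℝ, UnitAddTorus.mFourier k (toTorus x) *
      ∑ m ∈ S, a m * UnitAddTorus.mFourier m (toTorus x) =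
      ∑ m ∈ S, a m * UnitAddTorus.mFourier (k + m) (toTorus x) := by
    intro x
    rw [Finset.mul_sum]
    refine Finset.sum_congr rfl fun m _ => ?_
    rw [UnitAddTorus.mFourier_add]
    ring
  simp only [e]
  rw [integral_finsetSum _ fun m _ => (hi _).const_mul _]
  simp only [integral_const_mul, setIntegral_unitCube_mFourier, add_eq_zero_iff_neg_eq,
    mul_ite, mul_one, mul_zero, Finset.sum_ite_eq]

/-- If a trigonometric polynomial has the Fourier coefficients of a measure on the torus coming
from a measure on `ℝⁿ` that is carried by a set of measure less than one, it vanishes. -/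
lemma pullTransform_eq_zero_of_finite (hw : Integrable w lam) (hp : Measurable p)
    {F : Set (Fin n → ℝ)} (hF : MeasurableSet F) (hF1 : volume F < 1)
    (hwF : ∀ᵐ y ∂lam, p y ∉ F → w y = 0) {ξ : Fin n → ℝ}
    (hξ : {m : Fin n → ℤ | pullTransform lam w p (ξ + latticeVec m) ≠ 0}.Finite) :
    pullTransform lam w p ξ = 0 := by
  classical
  set S := hξ.toFinset with hS
  set a : (Fin n → ℤ) → ℂ := fun m => pullTransform lam w p (ξ + latticeVec m) with ha
  set P : (Fin n → ℝ) → ℂ := fun x => ∑ m ∈ S, a m * UnitAddTorus.mFourier m (toTorus x) with hP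
  set u : Y → ℂ := fun y => Complex.exp (-2 * Real.pi * Complex.I *
      ((∑ i, ξ i * p y i : ℝ) : ℂ)) * w y with hu
  have hfin : IsFiniteMeasure (volume.restrict (unitCube n)) :=
    ⟨by simp [volume_unitCube]⟩
  have hPc : Continuous P := by
    simp only [hP, mFourier_toTorus]
    fun_prop
  have hPi : Integrable P (volume.restrict (unitCube n)) := by
    refine Integrable.of_bound hPc.aestronglyMeasurable (∑ m ∈ S, ‖a m‖) (.of_forall fun x => ?_)
    refine (norm_sum_le _ _).trans (Finset.sum_le_sum fun m _ => ?_)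
    rw [norm_mul]
    refine mul_le_of_le_one_right (norm_nonneg _) ?_
    exact (ContinuousMap.norm_coe_le_norm _ _).trans UnitAddTorus.mFourier_norm.le
  -- The push-forwards of `u dλ` and of `P dx` on the cube have the same Fourier coefficients, so
  -- they are the same complex measure on the torus.
  have key : ∀ {B : Set (UnitAddTorus (Fin n))}, MeasurableSet B →
      ∫ y in (fun y => toTorus (p y)) ⁻¹' B, u y ∂lam =
        ∫ x in toTorus ⁻¹' B, P x ∂(volume.restrict (unitCube n)) := by
    intro B hB
    refine (determinesFiniteMeasures_mFourier n).setIntegral_preimage_eq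
      (integrable_character_mul hw hp ξ) hPi (measurable_toTorus.comp hp) measurable_toTorus ?_ hB
    rintro _ ⟨k, rfl⟩
    refine (integral_mFourier_mul_character k ξ).trans ?_
    rw [setIntegral_unitCube_mFourier_mul_trigPolynomial]
    by_cases hk : -k ∈ S
    · rw [if_pos hk]
    · rw [if_neg hk]
      simpa [hS] using hk
  set G := {x ∈ unitCube n | ∀ m : Fin n → ℤ, x + latticeVec m ∉ F} with hG
  have hGm : MeasurableSet G := measurableSet_unitCube_avoiding hF
  have hzero : ∀ G' : Set (Fin n → ℝ), MeasurableSet G' → G' ⊆ G → ∫ x in G', P x = 0 := by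
    intro G' hG' hsub
    have h1 := key (measurable_cubeRep hG')
    rw [Measure.restrict_restrict (measurable_toTorus (measurable_cubeRep hG'))] at h1
    have h2 : toTorus ⁻¹' (cubeRep ⁻¹' G') ∩ unitCube n = G' := by
      ext x
      constructor
      · rintro ⟨hx, hxQ⟩
        simpa [cubeRep_toTorus hxQ] using hx
      · intro hx
        have hxQ := (hsub hx).1
        exact ⟨by simpa [cubeRep_toTorus hxQ] using hx, hxQ⟩
    rw [h2] at h1
    rw [← h1]
    refine setIntegral_eq_zero_of_ae_eq_zero ?_
    filter_upwards [hwF] with y hy hyB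
    -- The point `p y` lies in the coset of a point of `G`, and such a coset avoids `F`.
    obtain ⟨k, hk⟩ := exists_eq_cubeRep_add_latticeVec (p y)
    have : p y ∉ F := by
      rw [hk]
      exact (hsub hyB).2 k
    simp [hu, hy this]
  have hPG : P =ᵐ[volume.restrict G] 0 := by
    refine ae_eq_zero_of_forall_setIntegral_eq_of_sigmaFinite ?_ ?_
    · intro s hs _
      exact (hPi.mono_measure (Measure.restrict_mono (fun x hx => hx.1) le_rfl)).integrableOn
    · intro s hs _
      rw [Measure.restrict_restrict hs]
      exact hzero _ (hs.inter hGm) Set.inter_subset_right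
  have hP0 : ∀ x, P x = 0 := by
    refine trigPolynomial_eq_zero S a fun h0 => ?_
    rw [Filter.EventuallyEq, ae_restrict_iff' hGm] at hPG
    refine volume_unitCube_avoiding_ne_zero hF hF1 (measure_mono_null_ae ?_ h0)
    filter_upwards [hPG] with x hx hxG using hx hxG
  -- The total mass of `u dλ` is the transform at `ξ`.
  have h1 := key MeasurableSet.univ
  simp only [Set.preimage_univ, Measure.restrict_univ, hP0, integral_zero] at h1
  exact h1

/-- Benedicks' argument on `ℝⁿ` with the integer lattice. -/
lemma ae_pullTransform_eq_zero (hw : Integrable w lam) (hp : Measurable p)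
    {F : Set (Fin n → ℝ)} (hF : MeasurableSet F) (hF1 : volume F < 1)
    (hwF : ∀ᵐ y ∂lam, p y ∉ F → w y = 0)
    (hm : MeasurableSet {ξ | pullTransform lam w p ξ ≠ 0})
    (hfin : volume {ξ | pullTransform lam w p ξ ≠ 0} ≠ ∞) :
    ∀ᵐ ξ, pullTransform lam w p ξ = 0 := by
  filter_upwards [ae_finite_add_latticeVec_mem hm hfin] with ξ hξ
  exact pullTransform_eq_zero_of_finite hw hp hF hF1 hwF hξ

end

/-! ### Characters of Euclidean space and dilations -/

/-- The characters of Euclidean space determine finite measures. -/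
lemma determinesFiniteMeasures_character (n : ℕ) :
    DeterminesFiniteMeasures (X := EuclideanSpace ℝ (Fin n))
      (Set.range fun y x => Complex.exp (-2 * Real.pi * Complex.I * (inner ℝ x y : ℝ))) := by
  refine ⟨?_, fun P P' hP hP' h => ?_⟩
  · rintro _ ⟨y, rfl⟩
    refine ⟨by fun_prop, ⟨1, fun x => (norm_exp_character _).le⟩, ⟨-y, ?_⟩⟩
    ext x
    simp [← Complex.exp_conj, Complex.conj_ofNat]
  · refine Measure.ext_of_charFun ?_
    ext t
    -- This frequency converts the normalization `exp(-2πi x·y)` into `exp(i x·t)` of `charFun`.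
    have := h _ ⟨(-(2 * Real.pi)⁻¹ : ℝ) • t, rfl⟩
    have e : ∀ x : EuclideanSpace ℝ (Fin n), (-2 * Real.pi * Complex.I *
        ((inner ℝ x ((-(2 * Real.pi)⁻¹ : ℝ) • t) : ℝ) : ℂ)) = (inner ℝ x t : ℝ) * Complex.I := by
      intro x
      rw [inner_smul_right]
      push_cast
      have : (Real.pi : ℂ) ≠ 0 := by exact_mod_cast Real.pi_ne_zero
      field_simp
    simp only [e] at this
    rw [charFun_apply, charFun_apply, this]

/-- For `n ≥ 1` and `c = 1/(V+1) ≤ 1` one has `cⁿ V ≤ c V < 1`. In dimension zero a dilation does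
not change volume. -/
lemma exists_scale {n : ℕ} (hn : 1 ≤ n) {V : ℝ≥0∞} (hV : V < ∞) :
    ∃ c : ℝ, 0 < c ∧ ENNReal.ofReal (c ^ n) * V < 1 := by
  have h0 : 0 ≤ V.toReal := ENNReal.toReal_nonneg
  refine ⟨(V.toReal + 1)⁻¹, by positivity, ?_⟩
  nth_rw 2 [← ENNReal.ofReal_toReal hV.ne]
  rw [← ENNReal.ofReal_mul (by positivity), ENNReal.ofReal_lt_one]
  have h1 : ((V.toReal + 1)⁻¹) ^ n ≤ (V.toReal + 1)⁻¹ :=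
    pow_le_of_le_one (by positivity) (inv_le_one_of_one_le₀ (by linarith)) (by omega)
  calc _ ≤ (V.toReal + 1)⁻¹ * V.toReal := by gcongr
    _ < 1 := by rw [inv_mul_lt_one₀ (by positivity)]; linarith

/-- Volume of the preimage of a set under a dilation onto Euclidean space. -/
lemma volume_preimage_smul_toLp {n : ℕ} {c : ℝ} (hc : 0 < c)
    {A : Set (EuclideanSpace ℝ (Fin n))} (hA : MeasurableSet A) :
    volume ((fun x : Fin n → ℝ => c • WithLp.toLp 2 x) ⁻¹' A) =
      ENNReal.ofReal (c⁻¹ ^ n) * volume A := by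
  have h1 := (PiLp.volume_preserving_toLp (Fin n)).measure_preimage
    ((measurable_const_smul c) hA).nullMeasurableSet
  have h2 := Measure.addHaar_preimage_smul (volume : Measure (EuclideanSpace ℝ (Fin n))) hc.ne' A
  rw [finrank_euclideanSpace_fin, ← inv_pow, abs_of_pos (by positivity)] at h2
  rw [← h2, ← h1]
  rfl

end MeasureLp

/-! ### The main theorem -/

open MeasureLp in
theorem mainTheorem2 (n : ℕ) (hn : 1 ≤ n)
    (μ : MeasureTheory.ComplexMeasure (EuclideanSpace ℝ (Fin n)))
    (hμM : MeasureLp.MemM 2 μ) (hμ : μ ≠ 0) :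
    ¬ ((∃ F : Set (EuclideanSpace ℝ (Fin n)),
          MeasureTheory.volume F < ⊤ ∧ MeasureLp.MeasureSupportedIn μ F) ∧
       (∃ E : Set (EuclideanSpace ℝ (Fin n)),
          MeasureTheory.volume E < ⊤ ∧
            MeasureLp.FunctionSupportedIn (MeasureLp.fourierStieltjes μ) E)) := by
  rintro ⟨⟨F, hF, hμF⟩, ⟨E, hE, hμE⟩⟩
  obtain ⟨lam, w, rfl, hfin, hw, hw1, hμw⟩ := exists_density_variation μ
  have hft : ∀ y, fourierStieltjes μ y = ∫ x, Complex.exp (-2 * Real.pi * Complex.I *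
      (inner ℝ x y : ℝ)) * w x ∂μ.variation := by
    intro y
    refine cintegral_eq_integral_mul hw hw1 hμw ?_
    exact Integrable.of_bound (Measurable.aestronglyMeasurable (by fun_prop)) 1
      (.of_forall fun x => (norm_exp_character _).le)
  have hcont : Continuous (fourierStieltjes μ) := by
    rw [show fourierStieltjes μ = _ from funext hft]
    refine continuous_of_dominated (bound := fun x => ‖w x‖) (fun y => ?_)
      (fun y => .of_forall fun x => ?_) hw.norm (.of_forall fun x => by fun_prop)
    · exact (Measurable.aestronglyMeasurable (by fun_prop)).mul hw.aestronglyMeasurable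
    · rw [norm_mul, norm_exp_character, one_mul]
  obtain ⟨c, hc, hcF⟩ := exists_scale hn hF
  -- Pushing along `x ↦ c x` replaces `F` by `cF`, of measure less than one, and the transform by `ξ
  -- ↦ μ̂(c ξ)`.
  set p : EuclideanSpace ℝ (Fin n) → Fin n → ℝ := fun x i => c * x i with hp
  have hpm : Measurable p := by fun_prop
  have hpull : ∀ ξ, pullTransform μ.variation w p ξ =
      fourierStieltjes μ (c • WithLp.toLp 2 ξ) := by
    intro ξ
    rw [hft, pullTransform]
    refine integral_congr_ae (.of_forall fun x => ?_)
    have : ∑ i, ξ i * p x i = inner ℝ x (c • WithLp.toLp 2 ξ) := by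
      simp only [hp, inner_smul_right, PiLp.inner_apply, Finset.mul_sum]
      refine Finset.sum_congr rfl fun i _ => ?_
      simp
      ring
    simp only [this]
  have hpc : Continuous (pullTransform μ.variation w p) := by
    rw [show pullTransform μ.variation w p = _ from funext hpull]
    exact hcont.comp (by fun_prop)
  -- `F` need not be measurable; a measurable hull has the same measure and still carries `μ`.
  set F' := toMeasurable volume F with hF'
  have hF'm : MeasurableSet F' := measurableSet_toMeasurable _ _
  have hwF : ∀ᵐ x ∂μ.variation, x ∉ F' → w x = 0 := by
    have h0 : w =ᵐ[μ.variation.restrict F'ᶜ] 0 := by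
      refine ae_eq_zero_of_forall_setIntegral_eq_of_sigmaFinite
        (fun s _ _ => hw.integrableOn.integrableOn) fun s hs _ => ?_
      rw [Measure.restrict_restrict hs, ← hμw _ (hs.inter hF'm.compl)]
      refine hμF _ (hs.inter hF'm.compl) (Set.disjoint_left.2 fun x hx hxF => ?_)
      exact hx.2 (subset_toMeasurable _ _ hxF)
    rw [Filter.EventuallyEq, ae_restrict_iff' hF'm.compl] at h0
    filter_upwards [h0] with x hx hxF using hx hxF
  have hae : ∀ᵐ ξ, pullTransform μ.variation w p ξ = 0 := by
    refine ae_pullTransform_eq_zero (F := (fun v => c⁻¹ • WithLp.toLp 2 v) ⁻¹' F') hw hpm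
      ?_ ?_ ?_ ?_ ?_
    · exact (by fun_prop : Measurable fun v : Fin n → ℝ => c⁻¹ • WithLp.toLp 2 v) hF'm
    · rw [volume_preimage_smul_toLp (inv_pos.2 hc) hF'm, inv_inv, measure_toMeasurable]
      exact hcF
    · filter_upwards [hwF] with x hx hxF
      refine hx fun hxF' => hxF ?_
      have : c⁻¹ • WithLp.toLp 2 (p x) = x := by
        ext i
        simp [hp, hc.ne']
      rwa [Set.mem_preimage, this]
    · exact (isOpen_ne_fun hpc continuous_const).measurableSet
    · have hA : MeasurableSet {y | fourierStieltjes μ y ≠ 0} :=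
        (isOpen_ne_fun hcont continuous_const).measurableSet
      have : {ξ | pullTransform μ.variation w p ξ ≠ 0} =
          (fun x => c • WithLp.toLp 2 x) ⁻¹' {y | fourierStieltjes μ y ≠ 0} := by
        ext ξ
        simp [hpull]
      rw [this, volume_preimage_smul_toLp hc hA]
      refine ENNReal.mul_ne_top ENNReal.ofReal_ne_top (ne_top_of_le_ne_top hE.ne ?_)
      refine measure_mono_ae ?_
      filter_upwards [hμE] with y hy hne
      by_contra hyE
      exact hne (hy hyE)
  have hall : pullTransform μ.variation w p = fun _ => 0 :=
    (Continuous.ae_eq_iff_eq volume hpc continuous_const).1 hae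
  have hzero : ∀ y, fourierStieltjes μ y = 0 := by
    intro y
    have := congrFun hall (c⁻¹ • WithLp.ofLp y)
    rw [hpull] at this
    rwa [WithLp.toLp_smul, smul_inv_smul₀ hc.ne'] at this
  refine hμ (VectorMeasure.ext fun A hA => ?_)
  -- Uniqueness is applied to `w` and the zero density, whose integrals against all characters
  -- agree.
  have := (determinesFiniteMeasures_character n).setIntegral_preimage_eq (v := fun _ => (0 : ℂ))
    hw (integrable_zero _ _ μ.variation) measurable_id measurable_id ?_ hA
  · rw [hμw A hA]
    simpa using this
  · rintro _ ⟨y, rfl⟩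
    simp only [id, mul_zero, integral_zero]
    rw [← hft, hzero]
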